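/- Let $I=[0,1]$ and let $\mathrm{Homeo}_+(I)$ be the group of orientation preserving (that is, strictly increasing) homeomorphisms of $I$, with the topology of the $C_0$ metric $d(f,g)=\max_{x\in I}|f(x)-g(x)|$. A topological group $G$ satisfies the Stability of the Generators Property if, whenever $g_1,\dots,g_n\in G$ generate a dense subgroup of $G$, there is an open neighborhood $U$ of the identity such that for all $h_1,\dots,h_n\in G$ with $h_i\in g_iU$ for $1\le i\le n$, the subgroup generated by $h_1,\dots,h_n$ is also dense. **Theorem.** 1. The topological group $\mathrm{Homeo}_+(I)$ does not satisfy the Stability of the Generators Property. 2. There are finitely many elements $g_1,\dots,g_n$ generating a dense subgroup of $\mathrm{Homeo}_+(I)$ such that for every $\varepsilon>0$ there are $h_1,\dots,h_n\in\mathrm{Homeo}_+(I)$ with $d(h_i,g_i)<\varepsilon$ for all $i$ which generate a discrete, non-dense subgroup. 3. In fact every finite tuple generating a dense subgroup is unstable in this way: if $g_1,\dots,g_n$ generate a dense subgroup of $\mathrm{Homeo}_+(I)$, then for every $\varepsilon>0$ there are $h_1,\dots,h_n\in\mathrm{Homeo}_+(I)$ with $d(h_i,g_i)<\varepsilon$ for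 all $i$ which generate a discrete, non-dense subgroup. -/

import Mathlib

/-- `Homeo₊(I)`: the group (under composition) of orientation preserving homeomorphisms of the
closed unit interval `I = [0,1]`, i.e. of the strictly increasing homeomorphisms `I → I`. -/
def HomeoPlusI : Subgroup (unitInterval ≃ₜ unitInterval) where
  carrier := {f | StrictMono f}
  one_mem' := fun _ _ h => h
  mul_mem' := fun {f g} (hf : StrictMono f) (hg : StrictMono g) => hf.comp hg
  inv_mem' := fun {f} (hf : StrictMono f) x y hxy => by
    have h : f (f.symm x) < f (f.symm y) := by simpa using hxy
    exact hf.lt_iff_lt.1 h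

namespace HomeoPlusI

/-- The underlying continuous self-map of `I`. -/
def toMap (f : HomeoPlusI) : C(unitInterval, unitInterval) :=
  ⟨fun x => f.1 x, f.1.continuous⟩

theorem toMap_injective : Function.Injective toMap := fun f g h =>
  Subtype.ext (Homeomorph.ext fun x => DFunLike.congr_fun h x)

/-- The `C₀` metric `d(f, g) = max_x |f x - g x|` on `Homeo₊(I)`, induced by the uniform metric
on continuous maps. -/
noncomputable instance : MetricSpace HomeoPlusI :=
  MetricSpace.induced toMap toMap_injective inferInstance

theorem dist_def (f g : HomeoPlusI) : dist f g = dist (toMap f) (toMap g) := rfl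

theorem dist_lt_iff (f g : HomeoPlusI) {ε : ℝ} (hε : 0 < ε) :
    dist f g < ε ↔ ∀ x : unitInterval, |(f.1 x : ℝ) - (g.1 x : ℝ)| < ε := by
  rw [dist_def, ContinuousMap.dist_lt_iff hε]
  rfl

theorem continuous_toMap : Continuous toMap := continuous_induced_dom

theorem dist_mul_right (f g h : HomeoPlusI) : dist (f * h) (g * h) = dist f g := by
  have key : ∀ f g h : HomeoPlusI, dist (f * h) (g * h) ≤ dist f g := fun f g h =>
    (ContinuousMap.dist_le dist_nonneg).2 fun x =>
      ContinuousMap.dist_apply_le_dist (f := toMap f) (g := toMap g) (h.1 x)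
  refine le_antisymm (key f g h) ?_
  simpa using key (f * h) (g * h) h⁻¹

theorem continuous_mul_prod : Continuous fun p : HomeoPlusI × HomeoPlusI => p.1 * p.2 := by
  refine continuous_induced_rng.2 ?_
  exact (continuous_toMap.comp continuous_fst).compCM (continuous_toMap.comp continuous_snd)

/-- With the `C₀` topology, `Homeo₊(I)` is a topological group. -/
instance : IsTopologicalGroup HomeoPlusI where
  continuous_mul := continuous_mul_prod
  continuous_inv := by
    refine continuous_iff_continuousAt.2 fun g => ?_
    refine tendsto_iff_dist_tendsto_zero.2 ?_
    have h : ∀ f : HomeoPlusI, dist f⁻¹ g⁻¹ = dist (g⁻¹ * f) 1 := fun f => by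
      rw [← dist_mul_right f⁻¹ g⁻¹ f, inv_mul_cancel, dist_comm]
    simp only [h]
    have hc : Continuous fun f : HomeoPlusI => dist (g⁻¹ * f) 1 :=
      (continuous_mul_prod.comp (continuous_const.prodMk continuous_id)).dist continuous_const
    simpa using hc.tendsto g

end HomeoPlusI

/-- The elements `g₁, …, gₙ` generate a dense subgroup of the topological group `G`. -/
def GeneratesDense {G : Type*} [Group G] [TopologicalSpace G] {n : ℕ} (g : Fin n → G) : Prop :=
  Dense (Subgroup.closure (Set.range g) : Set G)

/-- The elements `g₁, …, gₙ` generate a discrete subgroup of the topological group `G`. -/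
def GeneratesDiscrete {G : Type*} [Group G] [TopologicalSpace G] {n : ℕ} (g : Fin n → G) : Prop :=
  DiscreteTopology (Subgroup.closure (Set.range g))

open scoped Pointwise in
/-- The Stability of the Generators Property of a topological group `G`: whenever `g₁, …, gₙ`
generate a dense subgroup, there is an open neighbourhood `U` of the identity such that all
`h₁, …, hₙ` with `hᵢ ∈ gᵢ U` generate a dense subgroup as well. -/
def StabilityOfGenerators (G : Type*) [Group G] [TopologicalSpace G] [IsTopologicalGroup G] :
    Prop :=
  ∀ (n : ℕ) (g : Fin n → G), GeneratesDense g →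
    ∃ U : Set G, IsOpen U ∧ (1 : G) ∈ U ∧
      ∀ h : Fin n → G, (∀ i, h i ∈ g i • U) → GeneratesDense h

namespace HomeoPlusI

/-! Any finite tuple `g` can be perturbed by inserting a free group near the endpoint `0`. Choose
homeomorphisms `k i` all of whose nontrivial reduced words displace one point by at least `δ`
(`exists_uniform_displacement`: ping-pong on arcs of the circle, lifted to `ℝ` and compactified to
`I`). For small `p`, let `h i` act on `[0, p]` as a rescaled `k i` and on `[p, 1]` as a rescaled `g
i`. Uniform continuity makes `h i` close to `g i`. Every nontrivial word in `h` displaces one common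
point by at least `p * δ`; as the metric is right invariant, the group is uniformly separated, hence
discrete. It fixes the interior point `p`, hence is not dense.

It remains to exhibit a dense finitely generated subgroup. On `[-∞, ∞]`, translations by `1` and
`√2` together with a map supported on a half-line generate elements that fix everything up to `c`
and act far to the right as arbitrarily small translations. With such elements the values at
finitely many points can be adjusted from left to right (`dense_of_exists_fixing`), and monotonicity
controls the rest. -/

/-- An order automorphism of `I` as an element of `Homeo₊(I)`. -/
def ofOrderIso (f : unitInterval ≃o unitInterval) : HomeoPlusI :=
  ⟨f.toHomeomorph, f.strictMono⟩

theorem mul_apply (f g : HomeoPlusI) (x : unitInterval) : (f * g).1 x = f.1 (g.1 x) := rfl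

theorem apply_lt_apply (f : HomeoPlusI) {x y : unitInterval} : f.1 x < f.1 y ↔ x < y :=
  StrictMono.lt_iff_lt f.2

theorem apply_le_apply (f : HomeoPlusI) {x y : unitInterval} : f.1 x ≤ f.1 y ↔ x ≤ y :=
  StrictMono.le_iff_le f.2

theorem apply_zero (f : HomeoPlusI) : f.1 0 = 0 := by
  obtain ⟨x, hx⟩ := f.1.surjective 0
  exact le_antisymm (((apply_le_apply f).2 (bot_le : (0 : unitInterval) ≤ x)).trans_eq hx) bot_le

theorem apply_one (f : HomeoPlusI) : f.1 1 = 1 := by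
  obtain ⟨x, hx⟩ := f.1.surjective 1
  exact le_antisymm le_top (hx.symm.trans_le ((apply_le_apply f).2 (le_top : x ≤ (1 : unitInterval))))

theorem le_dist_of_apply {f g : HomeoPlusI} {r : ℝ} (x : unitInterval)
    (h : r ≤ |(f.1 x : ℝ) - g.1 x|) : r ≤ dist f g := by
  by_contra! hlt
  rcases le_or_gt r 0 with hr | hr
  · exact absurd (hr.trans dist_nonneg) hlt.not_ge
  · exact absurd ((dist_lt_iff f g hr).1 hlt x) h.not_gt

/-! ### Homeomorphisms of the line acting on the interval -/

/-- An identification of the extended real line with the unit interval. -/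
noncomputable def erealIso : EReal ≃o unitInterval :=
  ENNReal.logOrderIso.symm.trans ENNReal.orderIsoUnitIntervalBirational

/-- The extension of an order automorphism of `ℝ` to `[-∞, ∞]`. -/
noncomputable def erealExtend (f : ℝ ≃o ℝ) : EReal ≃o EReal :=
  (f.withTopCongr.withBotCongr : WithBot (WithTop ℝ) ≃o WithBot (WithTop ℝ))

theorem erealExtend_coe (f : ℝ ≃o ℝ) (x : ℝ) : erealExtend f x = (f x : ℝ) := rfl

/-- The action of the order automorphisms of `ℝ` on the unit interval, regarded as `[-∞, ∞]`. -/
noncomputable def lineHom : (ℝ ≃o ℝ) →* HomeoPlusI where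
  toFun f := ofOrderIso ((erealIso.symm.trans (erealExtend f)).trans erealIso)
  map_one' := by
    refine Subtype.ext (Homeomorph.ext fun x => ?_)
    obtain ⟨x, rfl⟩ := erealIso.surjective x
    change erealIso (erealExtend 1 (erealIso.symm (erealIso x))) = erealIso x
    rw [OrderIso.symm_apply_apply]
    induction x <;> rfl
  map_mul' f g := by
    refine Subtype.ext (Homeomorph.ext fun x => ?_)
    obtain ⟨x, rfl⟩ := erealIso.surjective x
    change erealIso (erealExtend (f * g) (erealIso.symm (erealIso x))) =
      erealIso (erealExtend f (erealIso.symm (erealIso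
        (erealExtend g (erealIso.symm (erealIso x))))))
    simp only [OrderIso.symm_apply_apply]
    induction x <;> rfl

theorem lineHom_apply (f : ℝ ≃o ℝ) (x : EReal) :
    (lineHom f).1 (erealIso x) = erealIso (erealExtend f x) := by
  change erealIso (erealExtend f (erealIso.symm (erealIso x))) = _
  rw [OrderIso.symm_apply_apply]

theorem lineHom_apply_coe (f : ℝ ≃o ℝ) (x : ℝ) :
    (lineHom f).1 (erealIso x) = erealIso (f x : ℝ) := lineHom_apply f x

theorem exists_coe_of_lt_of_lt {x y z : unitInterval} (hxy : x < y) (hyz : y < z) :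
    ∃ u : ℝ, erealIso u = y := by
  obtain ⟨x, rfl⟩ := erealIso.surjective x
  obtain ⟨y, rfl⟩ := erealIso.surjective y
  obtain ⟨z, rfl⟩ := erealIso.surjective z
  rw [OrderIso.lt_iff_lt] at hxy hyz
  lift y to ℝ using ⟨hyz.ne_top, hxy.ne_bot⟩
  exact ⟨y, rfl⟩

theorem exists_coe_between {x y : unitInterval} (hxy : x < y) :
    ∃ u : ℝ, x < erealIso u ∧ erealIso u < y := by
  obtain ⟨x, rfl⟩ := erealIso.surjective x
  obtain ⟨y, rfl⟩ := erealIso.surjective y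
  rw [OrderIso.lt_iff_lt] at hxy
  obtain ⟨u, h1, h2⟩ := EReal.lt_iff_exists_real_btwn.1 hxy
  exact ⟨u, erealIso.lt_iff_lt.2 h1, erealIso.lt_iff_lt.2 h2⟩

/-! ### A density criterion by grid approximation -/

/-- The point `i / N` of the unit interval, truncated at `1`. -/
noncomputable def gridPoint (N i : ℕ) : unitInterval := Set.projIcc 0 1 zero_le_one ((i : ℝ) / N)

theorem coe_gridPoint {N i : ℕ} (hi : i ≤ N) : (gridPoint N i : ℝ) = i / N := by
  rw [gridPoint, Set.projIcc_of_mem zero_le_one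
    ⟨by positivity, div_le_one_of_le₀ (by exact_mod_cast hi) (by positivity)⟩]

theorem gridPoint_lt {N i j : ℕ} (hij : i < j) (hj : j ≤ N) : gridPoint N i < gridPoint N j := by
  have hN : (0 : ℝ) < N := by exact_mod_cast (by omega : 0 < N)
  rw [← Subtype.coe_lt_coe, coe_gridPoint (hij.le.trans hj), coe_gridPoint hj]
  gcongr

theorem gridPoint_zero (N : ℕ) : gridPoint N 0 = 0 :=
  Subtype.ext (by rw [coe_gridPoint (Nat.zero_le N)]; simp)

theorem exists_gridPoint_le {N : ℕ} (hN : 0 < N) (y : unitInterval) :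
    ∃ i < N, gridPoint N i ≤ y ∧ y ≤ gridPoint N (i + 1) := by
  have hN' : (0 : ℝ) < N := by exact_mod_cast hN
  rcases eq_or_lt_of_le y.2.2 with h1 | h1
  · refine ⟨N - 1, by omega, ?_, ?_⟩
    · rw [← Subtype.coe_le_coe, h1]; exact (gridPoint N (N - 1)).2.2
    · rw [← Subtype.coe_le_coe, Nat.sub_add_cancel hN, coe_gridPoint le_rfl, div_self hN'.ne']
      exact y.2.2
  · have hlt : ⌊(N : ℝ) * y⌋₊ < N := by
      rw [Nat.floor_lt (mul_nonneg hN'.le y.2.1)]; nlinarith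
    refine ⟨⌊(N : ℝ) * y⌋₊, hlt, ?_, ?_⟩
    · rw [← Subtype.coe_le_coe, coe_gridPoint hlt.le, div_le_iff₀ hN', mul_comm]
      exact Nat.floor_le (mul_nonneg y.2.1 hN'.le)
    · rw [← Subtype.coe_le_coe, coe_gridPoint hlt, le_div_iff₀ hN', mul_comm]
      push_cast
      exact (Nat.lt_floor_add_one _).le

/-- A subgroup is dense if, on each `(c, 1]`, its elements fixing `[0, c]` pointwise have dense
orbits. -/
theorem dense_of_exists_fixing (G : Subgroup HomeoPlusI)
    (hG : ∀ c x y y' : unitInterval, c < x → x < 1 → c < y → y < y' →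
      ∃ g ∈ G, (∀ t ≤ c, g.1 t = t) ∧ y ≤ g.1 x ∧ g.1 x < y') :
    Dense (G : Set HomeoPlusI) := by
  refine Metric.dense_iff.2 fun f ε hε => ?_
  obtain ⟨N, hN⟩ := exists_nat_gt (2 / ε)
  have hN0 : (0 : ℝ) < N := lt_trans (by positivity) hN
  have hNpos : 0 < N := by exact_mod_cast hN0
  -- The preimages under `f` of the grid points are placed in their target cells one at a time, from
  -- left to right.
  have step : ∀ k < N, ∃ g ∈ G, ∀ i ≤ k,
      gridPoint N i ≤ g.1 (f.1.symm (gridPoint N i)) ∧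
        g.1 (f.1.symm (gridPoint N i)) < gridPoint N (i + 1) := by
    intro k
    induction k with
    | zero =>
      refine fun h => ⟨1, G.one_mem, fun i hi => ?_⟩
      obtain rfl : i = 0 := by omega
      have h0 : f.1.symm 0 = 0 := by rw [Homeomorph.symm_apply_eq, apply_zero]
      rw [gridPoint_zero, h0, apply_zero]
      exact ⟨le_rfl, gridPoint_zero N ▸ gridPoint_lt (by omega) (by omega)⟩
    | succ k ih =>
      intro hk
      obtain ⟨g, hg, hgi⟩ := ih (by omega)
      have hsymm : ∀ {x y : unitInterval}, x < y → f.1.symm x < f.1.symm y := fun {x y} h =>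
        (f⁻¹).2 h
      -- The correction `g'` fixes everything up to the last point already placed, so earlier
      -- placements survive.
      obtain ⟨g', hg', hfix, h1, h2⟩ := hG (g.1 (f.1.symm (gridPoint N k)))
        (g.1 (f.1.symm (gridPoint N (k + 1)))) (gridPoint N (k + 1)) (gridPoint N (k + 2))
        ((apply_lt_apply _).2 (hsymm (gridPoint_lt (by omega) (by omega))))
        (by
          rw [← apply_one g, apply_lt_apply]
          calc f.1.symm (gridPoint N (k + 1)) < f.1.symm (gridPoint N N) :=
                hsymm (gridPoint_lt hk le_rfl)
            _ ≤ 1 := unitInterval.le_one')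
        (hgi k le_rfl).2 (gridPoint_lt (by omega) (by omega))
      refine ⟨g' * g, G.mul_mem hg' hg, fun i hi => ?_⟩
      rw [mul_apply]
      rcases Nat.le_succ_iff.1 hi with hi | rfl
      · rw [hfix]
        · exact hgi i hi
        · rcases hi.eq_or_lt with rfl | hlt
          · exact le_rfl
          · exact ((apply_lt_apply _).2 (hsymm (gridPoint_lt hlt (by omega)))).le
      · exact ⟨h1, h2⟩
  obtain ⟨g, hg, hgi⟩ := step (N - 1) (by omega)
  refine ⟨g, ?_, hg⟩
  rw [Metric.mem_ball, dist_lt_iff _ _ hε]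
  intro x
  obtain ⟨i, hi, h1, h2⟩ := exists_gridPoint_le hNpos (f.1 x)
  have hx1 : f.1.symm (gridPoint N i) ≤ x := by
    rw [← apply_le_apply f, Homeomorph.apply_symm_apply]; exact h1
  have hx2 : x ≤ f.1.symm (gridPoint N (i + 1)) := by
    rw [← apply_le_apply f, Homeomorph.apply_symm_apply]; exact h2
  have hlow : (i : ℝ) / N ≤ g.1 x := by
    rw [← coe_gridPoint hi.le]
    exact (hgi i (by omega)).1.trans ((apply_le_apply g).2 hx1)
  have hup : (g.1 x : ℝ) ≤ (i + 2) / N := by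
    by_cases hlt : i + 1 < N
    · have := ((apply_le_apply g).2 hx2).trans (hgi (i + 1) (by omega)).2.le
      rw [← Subtype.coe_le_coe, coe_gridPoint (by omega)] at this
      push_cast at this
      calc _ ≤ _ := this
        _ = _ := by ring
    · have : (N : ℝ) ≤ i + 2 := by exact_mod_cast (by omega : N ≤ i + 2)
      exact (g.1 x).2.2.trans ((one_le_div hN0).2 this)
  have hf1 := Subtype.coe_le_coe.2 h1
  have hf2 := Subtype.coe_le_coe.2 h2
  rw [coe_gridPoint hi.le] at hf1
  rw [coe_gridPoint hi] at hf2
  push_cast at hf2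
  have hsmall : 2 / (N : ℝ) < ε := by
    rw [div_lt_iff₀ hN0]; rw [div_lt_iff₀ hε] at hN; linarith
  have e1 : ((i : ℝ) + 1) / N = i / N + 1 / N := by ring
  have e2 : ((i : ℝ) + 2) / N = i / N + 2 / N := by ring
  have e3 : (2 : ℝ) / N = 1 / N + 1 / N := by ring
  have e4 : 0 < 1 / (N : ℝ) := by positivity
  rw [abs_lt]
  constructor <;> linarith

/-! ### Three homeomorphisms of the line generating a dense subgroup -/

/-- The homeomorphism of `ℝ` that is the identity on the negative reals and doubles the
positive ones. -/
noncomputable def doublePos : ℝ ≃o ℝ where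
  toFun x := max x (2 * x)
  invFun x := min x (x / 2)
  left_inv x := by
    dsimp only
    rcases le_total x 0 with h | h
    · rw [max_eq_left (by linarith), min_eq_left (by linarith)]
    · rw [max_eq_right (by linarith), min_eq_right (by linarith)]; ring
  right_inv x := by
    dsimp only
    rcases le_total x 0 with h | h
    · rw [min_eq_left (by linarith), max_eq_left (by linarith)]
    · rw [min_eq_right (by linarith), max_eq_right (by linarith)]; ring
  map_rel_iff' {x y} := by
    simp only [Equiv.coe_fn_mk]
    constructor
    · intro h
      by_contra! hlt
      exact absurd h (max_lt_max hlt (by linarith)).not_ge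
    · intro h
      exact max_le_max h (by linarith)

/-- The conjugate of `doublePos` that fixes `(-∞, c]` and expands `[c, ∞)` by `2`. -/
noncomputable def doubleAbove (c : ℝ) : ℝ ≃o ℝ :=
  OrderIso.addRight c * doublePos * (OrderIso.addRight c)⁻¹

theorem doubleAbove_apply (c x : ℝ) : doubleAbove c x = max (x - c) (2 * (x - c)) + c := by
  rw [sub_eq_add_neg]; rfl

theorem doubleAbove_of_le {c x : ℝ} (h : x ≤ c) : doubleAbove c x = x := by
  rw [doubleAbove_apply, max_eq_left (by linarith)]; ring

theorem doubleAbove_of_ge {c x : ℝ} (h : c ≤ x) : doubleAbove c x = 2 * x - c := by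
  rw [doubleAbove_apply, max_eq_right (by linarith)]; ring

/-- A homeomorphism of `ℝ` that fixes `(-∞, c]` and translates `[c + d, ∞)` by `d`. -/
noncomputable def shiftAbove (c d : ℝ) : ℝ ≃o ℝ := doubleAbove c * (doubleAbove (c + d))⁻¹

theorem shiftAbove_of_le {c d x : ℝ} (hd : 0 ≤ d) (h : x ≤ c) : shiftAbove c d x = x := by
  change doubleAbove c ((doubleAbove (c + d)).symm x) = x
  have : (doubleAbove (c + d)).symm x = x := by
    rw [OrderIso.symm_apply_eq, doubleAbove_of_le (by linarith)]
  rw [this, doubleAbove_of_le h]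

/-- Here the two factors are affine with slopes `1 / 2` and `2` about the centres `c + d` and `c`,
so the slopes cancel. -/
theorem shiftAbove_of_ge {c d x : ℝ} (hd : 0 ≤ d) (h : c + d ≤ x) :
    shiftAbove c d x = x + d := by
  change doubleAbove c ((doubleAbove (c + d)).symm x) = x + d
  have : (doubleAbove (c + d)).symm x = (x + (c + d)) / 2 := by
    rw [OrderIso.symm_apply_eq, doubleAbove_of_ge (by linarith)]; ring
  rw [this, doubleAbove_of_ge (by linarith)]; ring

theorem shiftAbove_pow_of_ge {c d x : ℝ} (hd : 0 ≤ d) (h : c + d ≤ x) (m : ℕ) :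
    (shiftAbove c d ^ m) x = x + m * d := by
  induction m with
  | zero => rw [pow_zero, Nat.cast_zero, zero_mul, add_zero]; rfl
  | succ m ih =>
    rw [pow_succ']
    change shiftAbove c d ((shiftAbove c d ^ m) x) = _
    have : 0 ≤ m * d := by positivity
    rw [ih, shiftAbove_of_ge hd (by linarith)]
    push_cast; ring

theorem shiftAbove_zpow_of_le {c d x : ℝ} (hd : 0 ≤ d) (h : x ≤ c) (m : ℤ) :
    (shiftAbove c d ^ m) x = x := by
  have key : ∀ m : ℕ, (shiftAbove c d ^ m) x = x := by
    intro m
    induction m with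
    | zero => rfl
    | succ m ih =>
      rw [pow_succ']
      change shiftAbove c d ((shiftAbove c d ^ m) x) = _
      rw [ih, shiftAbove_of_le hd h]
  rcases m with m | m
  · exact key m
  · rw [zpow_negSucc]
    change (shiftAbove c d ^ (m + 1)).symm x = x
    rw [OrderIso.symm_apply_eq, key]

theorem shiftAbove_zpow_of_ge {c d x : ℝ} (hd : 0 ≤ d) (h : c + d ≤ x) (m : ℤ)
    (hm : c + d ≤ x + m * d) : (shiftAbove c d ^ m) x = x + m * d := by
  rcases m with m | m
  · simpa using shiftAbove_pow_of_ge hd h m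
  · rw [zpow_negSucc]
    change (shiftAbove c d ^ (m + 1)).symm x = _
    rw [OrderIso.symm_apply_eq, shiftAbove_pow_of_ge hd hm]
    push_cast; ring

/-- Translations by `1` and `√2` and the map `doublePos`. -/
noncomputable def lineGenerators : Fin 3 → ℝ ≃o ℝ :=
  ![OrderIso.addRight 1, OrderIso.addRight √2, doublePos]

theorem addRight_mem_closure {c : ℝ} (hc : c ∈ AddSubgroup.closure {1, √2}) :
    OrderIso.addRight c ∈ Subgroup.closure (Set.range lineGenerators) := by
  induction hc using AddSubgroup.closure_induction with
  | mem x hx =>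
    rcases hx with rfl | rfl
    · exact Subgroup.subset_closure ⟨0, rfl⟩
    · exact Subgroup.subset_closure ⟨1, rfl⟩
  | zero =>
    convert Subgroup.one_mem _
    exact RelIso.ext fun x => add_zero x
  | add x y _ _ hx hy =>
    convert Subgroup.mul_mem _ hy hx
    exact RelIso.ext fun z => (add_assoc z x y).symm
  | neg x _ hx =>
    convert Subgroup.inv_mem _ hx
    exact RelIso.ext fun z => rfl

theorem doubleAbove_mem_closure {c : ℝ} (hc : c ∈ AddSubgroup.closure {1, √2}) :
    doubleAbove c ∈ Subgroup.closure (Set.range lineGenerators) :=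
  Subgroup.mul_mem _ (Subgroup.mul_mem _ (addRight_mem_closure hc)
    (Subgroup.subset_closure ⟨2, rfl⟩)) (Subgroup.inv_mem _ (addRight_mem_closure hc))

theorem exists_fixing_mem_closure {c x y y' : ℝ} (hx : c < x) (hy : c < y) (hy' : y < y') :
    ∃ g ∈ Subgroup.closure (Set.range lineGenerators),
      (∀ t ≤ c, g t = t) ∧ y ≤ g x ∧ g x < y' := by
  have hD : Dense (AddSubgroup.closure {1, √2} : Set ℝ) := by
    rw [Set.pair_comm, dense_addSubgroupClosure_pair_iff, div_one]
    exact irrational_sqrt_two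
  obtain ⟨a, haD, hca, ha⟩ := hD.exists_between (lt_min hx hy)
  obtain ⟨d, hdD, hd, hdm⟩ := hD.exists_between
    (lt_min (sub_pos.2 hy') (sub_pos.2 ha))
  have hd1 := lt_of_lt_of_le hdm (min_le_left _ _)
  have hd2 := lt_of_lt_of_le hdm (min_le_right _ _)
  have hmx := min_le_left x y
  have hmy := min_le_right x y
  -- The least number of steps of length `d` taking `x` to `y` or beyond; the overshoot is less than
  -- `d < y' - y`.
  set m : ℤ := ⌈(y - x) / d⌉
  have h1 : y - x ≤ m * d := (div_le_iff₀ hd).1 (Int.le_ceil _)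
  have h2 : m * d < y - x + d := by
    have := (mul_lt_mul_iff_of_pos_right hd).2 (Int.ceil_lt_add_one ((y - x) / d))
    rwa [add_mul, div_mul_cancel₀ _ hd.ne', one_mul] at this
  refine ⟨shiftAbove a d ^ m, Subgroup.zpow_mem _ (Subgroup.mul_mem _ (doubleAbove_mem_closure haD)
    (Subgroup.inv_mem _ (doubleAbove_mem_closure (add_mem haD hdD)))) m, fun t ht =>
    shiftAbove_zpow_of_le hd.le (ht.trans hca.le) m, ?_⟩
  rw [shiftAbove_zpow_of_ge hd.le (by linarith) m (by linarith)]
  constructor <;> linarith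

theorem generatesDense_lineGenerators :
    GeneratesDense fun i => lineHom (lineGenerators i) := by
  refine dense_of_exists_fixing _ fun c x y y' hcx hx1 hcy hyy' => ?_
  obtain ⟨x, rfl⟩ := exists_coe_of_lt_of_lt hcx hx1
  obtain ⟨y, rfl⟩ := exists_coe_of_lt_of_lt hcy hyy'
  obtain ⟨a, hca, ha⟩ := exists_coe_between (lt_min hcx hcy)
  obtain ⟨z, hyz, hz⟩ := exists_coe_between hyy'
  rw [lt_min_iff] at ha
  simp only [OrderIso.lt_iff_lt, EReal.coe_lt_coe_iff] at ha hyz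
  obtain ⟨g, hg, hfix, h1, h2⟩ := exists_fixing_mem_closure ha.1 ha.2 hyz
  refine ⟨lineHom g, ?_, fun t ht => ?_, ?_, ?_⟩
  · have := Subgroup.mem_map_of_mem lineHom hg
    rwa [MonoidHom.map_closure, ← Set.range_comp] at this
  · obtain ⟨t, rfl⟩ := erealIso.surjective t
    have hta := ht.trans_lt hca
    rw [OrderIso.lt_iff_lt] at hta
    rw [lineHom_apply]
    congr 1
    induction t with
    | bot => rfl
    | top => exact absurd hta not_top_lt
    | coe t => rw [erealExtend_coe, hfix t (EReal.coe_lt_coe_iff.1 hta).le]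
  · rw [lineHom_apply_coe, OrderIso.le_iff_le]
    exact_mod_cast h1
  · rw [lineHom_apply_coe]
    refine lt_trans (erealIso.lt_iff_lt.2 ?_) hz
    exact_mod_cast h2


/-! ### Ping-pong on the circle, lifted to the line -/

/-- The birational self-map `t ↦ K t / (1 - t + K t)` of `[0, 1)`. -/
noncomputable def birational (K t : ℝ) : ℝ := K * t / (1 - t + K * t)

theorem birational_denom_pos {K t : ℝ} (hK : 0 < K) (h0 : 0 ≤ t) (h1 : t < 1) :
    0 < 1 - t + K * t := by
  have := mul_nonneg hK.le h0
  linarith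

theorem birational_nonneg {K t : ℝ} (hK : 0 < K) (h0 : 0 ≤ t) (h1 : t < 1) :
    0 ≤ birational K t :=
  div_nonneg (mul_nonneg hK.le h0) (birational_denom_pos hK h0 h1).le

theorem birational_lt_one {K t : ℝ} (hK : 0 < K) (h0 : 0 ≤ t) (h1 : t < 1) :
    birational K t < 1 := by
  rw [birational, div_lt_one (birational_denom_pos hK h0 h1)]
  linarith

theorem birational_le_birational {K s t : ℝ} (hK : 0 < K) (h0 : 0 ≤ s) (hst : s ≤ t)
    (h1 : t < 1) : birational K s ≤ birational K t := by
  rw [birational, birational, div_le_div_iff₀ (birational_denom_pos hK h0 (hst.trans_lt h1))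
    (birational_denom_pos hK (h0.trans hst) h1)]
  have := mul_le_mul_of_nonneg_left hst hK.le
  linarith

/-- In the coordinate `t / (1 - t)` the map is multiplication by `K`. -/
theorem birational_inv_birational {K t : ℝ} (hK : 0 < K) (h0 : 0 ≤ t) (h1 : t < 1) :
    birational K⁻¹ (birational K t) = t := by
  have hd := (birational_denom_pos hK h0 h1).ne'
  have e : 1 - birational K t + K⁻¹ * birational K t = 1 / (1 - t + K * t) := by
    rw [birational]; field_simp; ring
  rw [birational, e, birational]
  field_simp

/-- The lift to `ℝ` of the self-map of the circle `ℝ / ℤ` given by `birational K`. -/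
noncomputable def circleLiftFun (K x : ℝ) : ℝ := ⌊x⌋ + birational K (Int.fract x)

theorem circleLiftFun_int_add {K t : ℝ} (k : ℤ) (h0 : 0 ≤ t) (h1 : t < 1) :
    circleLiftFun K (k + t) = k + birational K t := by
  have hf : ⌊(k : ℝ) + t⌋ = k := by
    rw [Int.floor_intCast_add, Int.floor_eq_zero_iff.2 ⟨h0, h1⟩, add_zero]
  rw [circleLiftFun, Int.fract, hf, add_sub_cancel_left]

theorem circleLiftFun_inv_circleLiftFun {K : ℝ} (hK : 0 < K) (x : ℝ) :
    circleLiftFun K⁻¹ (circleLiftFun K x) = x := by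
  have h0 := Int.fract_nonneg x
  have h1 := Int.fract_lt_one x
  rw [circleLiftFun.eq_def K, circleLiftFun_int_add _ (birational_nonneg hK h0 h1)
    (birational_lt_one hK h0 h1), birational_inv_birational hK h0 h1, Int.floor_add_fract]

theorem monotone_circleLiftFun {K : ℝ} (hK : 0 < K) : Monotone (circleLiftFun K) := by
  intro x y hxy
  rw [circleLiftFun, circleLiftFun]
  rcases (Int.floor_mono hxy).eq_or_lt with h | h
  · have : Int.fract x ≤ Int.fract y := by rw [Int.fract, Int.fract, h]; linarith
    rw [h]
    gcongr
    exact birational_le_birational hK (Int.fract_nonneg x) this (Int.fract_lt_one y)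
  · have h1 := birational_lt_one hK (Int.fract_nonneg x) (Int.fract_lt_one x)
    have h2 := birational_nonneg hK (Int.fract_nonneg y) (Int.fract_lt_one y)
    have h3 : ((⌊x⌋ : ℝ) + 1) ≤ ⌊y⌋ := by exact_mod_cast h
    linarith

/-- `circleLiftFun` as an order automorphism of `ℝ`. -/
noncomputable def circleLift (K : ℝ) (hK : 0 < K) : ℝ ≃o ℝ :=
  Equiv.toOrderIso
    { toFun := circleLiftFun K
      invFun := circleLiftFun K⁻¹
      left_inv := circleLiftFun_inv_circleLiftFun hK
      right_inv := fun x => by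
        simpa using circleLiftFun_inv_circleLiftFun (inv_pos.2 hK) x }
    (monotone_circleLiftFun hK) (monotone_circleLiftFun (inv_pos.2 hK))

/-- The preimage in `ℝ` of the arc `[j / M, (j + 1) / M)` of the circle `ℝ / ℤ`. -/
def arc (M j : ℕ) : Set ℝ := {x | ∃ k : ℤ, (j : ℝ) / M ≤ x - k ∧ x - k < (j + 1) / M}

/-- Both `i + k * M` and `j + l * M` are the integer part of `M * x`; reduce modulo `M`. -/
theorem arc_index_unique {M i j : ℕ} (hi : i < M) (hj : j < M) {x : ℝ} (hxi : x ∈ arc M i)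
    (hxj : x ∈ arc M j) : i = j := by
  have hM : (0 : ℝ) < M := by exact_mod_cast (Nat.zero_le i).trans_lt hi
  obtain ⟨k, hk1, hk2⟩ := hxi
  obtain ⟨l, hl1, hl2⟩ := hxj
  rw [div_le_iff₀ hM] at hk1 hl1
  rw [lt_div_iff₀ hM] at hk2 hl2
  have h1 : (i : ℤ) + k * M < j + 1 + l * M := by
    have : (i : ℝ) + k * M < j + 1 + l * M := by linarith
    exact_mod_cast this
  have h2 : (j : ℤ) + l * M < i + 1 + k * M := by
    have : (j : ℝ) + l * M < i + 1 + k * M := by linarith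
    exact_mod_cast this
  have h3 : (i : ℤ) + k * M = j + l * M := by omega
  have h4 := congrArg (· % (M : ℤ)) h3
  simp only [Int.add_mul_emod_self_right] at h4
  rw [Int.emod_eq_of_lt (by omega) (by omega), Int.emod_eq_of_lt (by omega) (by omega)] at h4
  exact_mod_cast h4

/-- A lift to `ℝ` of a circle homeomorphism that maps the complement of the `a`-th of `m + 2` arcs
onto the `b`-th arc. -/
noncomputable def arcSwap (m a b : ℕ) : ℝ ≃o ℝ :=
  OrderIso.addRight ((b + 1 : ℝ) / (m + 2 : ℕ)) * circleLift ((m + 1) ^ 2) (by positivity) *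
    (OrderIso.addRight ((a : ℝ) / (m + 2 : ℕ)))⁻¹

theorem arcSwap_apply (m a b : ℕ) (x : ℝ) : arcSwap m a b x =
    circleLiftFun ((m + 1) ^ 2) (x - (a : ℝ) / (m + 2 : ℕ)) + (b + 1 : ℝ) / (m + 2 : ℕ) := by
  rw [sub_eq_add_neg]; rfl

/-- With `M = m + 2`, multiplying `t / (1 - t)` by `(m + 1) ^ 2` sends `1 / M` to `1 - 1 / M`. Hence
`[1 / M, 1)` goes into the last arc, which the final rotation carries to arc `b`. -/
theorem arcSwap_mem_arc {m a : ℕ} (b : ℕ) {x : ℝ} (hx : x ∉ arc (m + 2) a) :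
    arcSwap m a b x ∈ arc (m + 2) b := by
  have hM : (0 : ℝ) < (m + 2 : ℕ) := by positivity
  set z := x - (a : ℝ) / (m + 2 : ℕ) with hz
  have hz' : z = ⌊z⌋ + Int.fract z := (Int.floor_add_fract z).symm
  have h0 := Int.fract_nonneg z
  have h1 := Int.fract_lt_one z
  have hf : 1 / ((m + 2 : ℕ) : ℝ) ≤ Int.fract z := by
    by_contra! hlt
    refine hx ⟨⌊z⌋, ?_, ?_⟩
    · linarith
    · rw [add_div]; linarith
  have hK : (0 : ℝ) < (m + 1) ^ 2 := by positivity
  have hs := birational_le_birational hK (by positivity) hf h1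
  have hs1 := birational_lt_one hK h0 h1
  have hval : birational ((m + 1) ^ 2 : ℝ) (1 / (m + 2 : ℕ)) = 1 - 1 / (m + 2 : ℕ) := by
    rw [birational]
    push_cast
    have h2 : (m : ℝ) + 2 ≠ 0 := by positivity
    have h3 : 1 - 1 / ((m : ℝ) + 2) + (m + 1) ^ 2 * (1 / ((m : ℝ) + 2)) = m + 1 := by
      field_simp; ring
    have h4 : (m : ℝ) + 1 ≠ 0 := by positivity
    rw [h3]
    field_simp
    ring
  rw [hval] at hs
  refine ⟨⌊z⌋ + 1, ?_⟩
  rw [arcSwap_apply, ← hz, circleLiftFun]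
  have e : ((b : ℝ) + 1) / (m + 2 : ℕ) = b / (m + 2 : ℕ) + 1 / (m + 2 : ℕ) := add_div _ _ _
  push_cast at *
  constructor <;> linarith

/-- The ping-pong lemma for reduced words. -/
theorem pingPong_mem {α : Type*} (a : α → ℝ ≃o ℝ) (A : α × Bool → Set ℝ)
    (hA : ∀ p q x, x ∈ A p → x ∈ A q → p = q) (x₀ : ℝ) (h₀ : ∀ p, x₀ ∉ A p)
    (ha : ∀ i x, x ∉ A (i, false) → a i x ∈ A (i, true)) (L : List (α × Bool)) :
    ∀ p, FreeGroup.IsReduced (p :: L) → FreeGroup.lift a (FreeGroup.mk (p :: L)) x₀ ∈ A p := by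
  have hinv : ∀ i x, x ∉ A (i, true) → (a i)⁻¹ x ∈ A (i, false) := by
    intro i x hx
    by_contra h
    refine hx ?_
    have := ha i _ h
    rwa [RelIso.apply_inv_self] at this
  have hstep : ∀ (p : α × Bool) x, x ∉ A (p.1, !p.2) →
      (cond p.2 (a p.1) (a p.1)⁻¹) x ∈ A p := by
    rintro ⟨i, b⟩ x hx
    cases b
    · exact hinv i x hx
    · exact ha i x hx
  induction L with
  | nil =>
    intro p _
    rw [FreeGroup.lift_mk, List.map_singleton, List.prod_singleton]
    exact hstep p _ (h₀ _)
  | cons q L ih =>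
    intro p hp
    rw [FreeGroup.isReduced_cons_cons] at hp
    have hq := ih q hp.2
    rw [FreeGroup.lift_mk] at hq ⊢
    rw [List.map_cons, List.prod_cons]
    -- Otherwise disjointness would make `q` the inverse letter of `p`, contradicting reducedness.
    refine hstep p _ fun h => ?_
    have := hA _ _ _ h hq
    have h1 : p.1 = q.1 := (Prod.ext_iff.1 this).1
    have h2 := hp.1 h1
    have h3 : (!p.2) = q.2 := (Prod.ext_iff.1 this).2
    rw [h2] at h3
    cases hq2 : q.2 <;> simp [hq2] at h3

/-- There are `n` homeomorphisms all of whose nontrivial reduced words displace some fixed point by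
a definite amount. -/
theorem exists_uniform_displacement (n : ℕ) :
    ∃ (k : Fin n → HomeoPlusI) (x : unitInterval) (δ : ℝ), 0 < δ ∧
      ∀ w : FreeGroup (Fin n), w ≠ 1 → δ ≤ |((FreeGroup.lift k w).1 x : ℝ) - x| := by
  -- Of the `2 * n + 2` arcs, each generator uses two. The last arc stays free, and its lift `[lo,
  -- 1)` contains the base point `x₀`.
  set a : Fin n → ℝ ≃o ℝ := fun i => arcSwap (2 * n) (2 * i) (2 * i + 1)
  set A : Fin n × Bool → Set ℝ := fun p => arc (2 * n + 2) (2 * p.1 + p.2.toNat)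
  have hM : (0 : ℝ) < (2 * n + 2 : ℕ) := by positivity
  set lo : ℝ := ((2 * n + 1 : ℕ) : ℝ) / (2 * n + 2 : ℕ)
  have hlo : lo < 1 := by
    rw [div_lt_one hM]; exact_mod_cast Nat.lt_succ_self _
  have hidx : ∀ p : Fin n × Bool, 2 * (p.1 : ℕ) + p.2.toNat < 2 * n + 1 := fun p => by
    have := p.1.2
    have := Bool.toNat_le p.2
    omega
  have hgap : ∀ p, ∀ x ∈ A p, lo < x → 1 ≤ x := by
    intro p x hx hlx
    by_contra! hx1
    have := arc_index_unique (j := 2 * n + 1) ((hidx p).trans (Nat.lt_succ_self _))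
      (Nat.lt_succ_self _) hx ⟨0, by rw [Int.cast_zero, sub_zero]; exact hlx.le, by
        have : ((2 * n + 1 : ℕ) : ℝ) + 1 = (2 * n + 2 : ℕ) := by push_cast; ring
        rw [this, div_self hM.ne', Int.cast_zero, sub_zero]; exact hx1⟩
    exact absurd this (hidx p).ne
  set x₀ : ℝ := (lo + 1) / 2
  have hx1 : lo < x₀ := by simp only [x₀]; linarith
  have hx2 : x₀ < 1 := by simp only [x₀]; linarith
  have hword : ∀ w : FreeGroup (Fin n), w ≠ 1 → ∃ p, FreeGroup.lift a w x₀ ∈ A p := by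
    intro w hw
    have hred : FreeGroup.IsReduced w.toWord := FreeGroup.isReduced_toWord
    rw [← FreeGroup.mk_toWord (x := w)]
    rcases hL : w.toWord with _ | ⟨p, L⟩
    · exact absurd (FreeGroup.toWord_eq_nil_iff.1 hL) hw
    · rw [hL] at hred
      refine ⟨p, pingPong_mem a A ?_ x₀ (fun p hp => ?_) (fun i x hx => ?_) L p hred⟩
      · intro p q x hp hq
        have h := arc_index_unique ((hidx p).trans (Nat.lt_succ_self _))
          ((hidx q).trans (Nat.lt_succ_self _)) hp hq
        rcases p with ⟨i, _ | _⟩ <;> rcases q with ⟨j, _ | _⟩ <;>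
          simp only [Bool.toNat_true, Bool.toNat_false] at h <;>
          first
          | omega
          | rw [show i = j from Fin.ext (by omega)]
      · exact absurd (hgap p _ hp hx1) hx2.not_ge
      · exact arcSwap_mem_arc _ hx
  have hl : erealIso lo < erealIso x₀ := erealIso.lt_iff_lt.2 (by exact_mod_cast hx1)
  have hr : erealIso x₀ < erealIso (1 : ℝ) := erealIso.lt_iff_lt.2 (by exact_mod_cast hx2)
  refine ⟨fun i => lineHom (a i), erealIso x₀,
    -- A nontrivial word sends `x₀` out of the interval `(lo, 1)`, so the images of `lo` and `1` in
    -- `I` are barriers independent of the word.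
    min ((erealIso x₀ : ℝ) - erealIso lo) ((erealIso (1 : ℝ) : ℝ) - erealIso x₀),
    lt_min (sub_pos.2 hl) (sub_pos.2 hr), fun w hw => ?_⟩
  have hcomp : FreeGroup.lift (fun i => lineHom (a i)) w = lineHom (FreeGroup.lift a w) := by
    have : FreeGroup.lift (fun i => lineHom (a i)) = lineHom.comp (FreeGroup.lift a) :=
      FreeGroup.ext_hom _ _ fun i => by simp
    rw [this]; rfl
  rw [hcomp, lineHom_apply_coe]
  obtain ⟨p, hp⟩ := hword w hw
  rcases le_or_gt (FreeGroup.lift a w x₀) lo with h | h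
  · have : erealIso (FreeGroup.lift a w x₀ : ℝ) ≤ erealIso lo :=
      erealIso.le_iff_le.2 (by exact_mod_cast h)
    rw [← Subtype.coe_le_coe] at this
    refine (min_le_left _ _).trans (le_trans ?_ (neg_le_abs _))
    linarith
  · have : erealIso (1 : ℝ) ≤ erealIso (FreeGroup.lift a w x₀ : ℝ) :=
      erealIso.le_iff_le.2 (by exact_mod_cast hgap p _ hp h)
    rw [← Subtype.coe_le_coe] at this
    refine (min_le_right _ _).trans (le_trans ?_ (le_abs_self _))
    linarith

/-! ### Gluing two homeomorphisms at an interior point -/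

section Concat

/-- The affine embedding of `I` onto `[0, p]`. -/
noncomputable def lowerPart (p t : unitInterval) : unitInterval := p * t

/-- The affine embedding of `I` onto `[p, 1]`. -/
noncomputable def upperPart (p t : unitInterval) : unitInterval :=
  ⟨p + (1 - p) * t, by
    have := p.2.1; have := p.2.2; have := t.2.1; have := t.2.2
    constructor <;> nlinarith⟩

theorem coe_lowerPart (p t : unitInterval) : (lowerPart p t : ℝ) = p * t := rfl

theorem coe_upperPart (p t : unitInterval) : (upperPart p t : ℝ) = p + (1 - p) * t := rfl

theorem lowerPart_or_upperPart {p : unitInterval} (h0 : 0 < p) (h1 : p < 1) (x : unitInterval) :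
    (∃ t, x = lowerPart p t) ∨ ∃ t, x = upperPart p t := by
  have h0' : (0 : ℝ) < p := h0
  have h1' : (p : ℝ) < 1 := h1
  rcases le_total (x : ℝ) p with h | h
  · refine Or.inl ⟨⟨x / p, div_nonneg x.2.1 h0'.le, (div_le_one h0').2 h⟩, Subtype.ext ?_⟩
    rw [coe_lowerPart]; field_simp
  · have h2 : (0 : ℝ) < 1 - p := by linarith
    refine Or.inr ⟨⟨(x - p) / (1 - p), div_nonneg (by linarith) h2.le,
      (div_le_one h2).2 (by linarith [x.2.2])⟩, Subtype.ext ?_⟩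
    rw [coe_upperPart]; field_simp; ring

/-- The map acting as `f` on `[0, p]` and as `g` on `[p, 1]`, up to affine rescaling. -/
noncomputable def concatFun (p : unitInterval) (f g : unitInterval → unitInterval)
    (x : unitInterval) : unitInterval :=
  ⟨p * f (Set.projIcc 0 1 zero_le_one ((x : ℝ) / p)) +
      (1 - p) * g (Set.projIcc 0 1 zero_le_one (((x : ℝ) - p) / (1 - p))), by
    have := p.2.1
    have := p.2.2
    have h1 := (f (Set.projIcc 0 1 zero_le_one ((x : ℝ) / p))).2
    have h2 := (g (Set.projIcc 0 1 zero_le_one (((x : ℝ) - p) / (1 - p)))).2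
    constructor <;> nlinarith [h1.1, h1.2, h2.1, h2.2]⟩

theorem coe_concatFun (p : unitInterval) (f g : unitInterval → unitInterval) (x : unitInterval) :
    (concatFun p f g x : ℝ) = p * f (Set.projIcc 0 1 zero_le_one ((x : ℝ) / p)) +
      (1 - p) * g (Set.projIcc 0 1 zero_le_one (((x : ℝ) - p) / (1 - p))) := rfl

/-- On `[0, p]` the argument of `g` is clamped to `0`, which `g` fixes, so the second summand
vanishes. -/
theorem concatFun_lowerPart {p : unitInterval} (h0 : 0 < p) (h1 : p < 1) (f g : HomeoPlusI)
    (t : unitInterval) : concatFun p f.1 g.1 (lowerPart p t) = lowerPart p (f.1 t) := by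
  have h0' : (0 : ℝ) < p := h0
  have h1' : (p : ℝ) < 1 := h1
  refine Subtype.ext ?_
  rw [coe_concatFun, coe_lowerPart, coe_lowerPart]
  have e1 : (p : ℝ) * t / p = t := by field_simp
  have e2 : ((p : ℝ) * t - p) / (1 - p) ≤ 0 :=
    div_nonpos_of_nonpos_of_nonneg (by nlinarith [t.2.2]) (by linarith)
  have e3 := apply_zero g
  rw [e1, Set.projIcc_val, Set.projIcc_of_le_left _ e2]
  change (p : ℝ) * f.1 t + (1 - p) * (g.1 0 : unitInterval) = _
  rw [e3]
  simp

theorem concatFun_upperPart {p : unitInterval} (h0 : 0 < p) (h1 : p < 1) (f g : HomeoPlusI)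
    (t : unitInterval) : concatFun p f.1 g.1 (upperPart p t) = upperPart p (g.1 t) := by
  have h0' : (0 : ℝ) < p := h0
  have h1' : (0 : ℝ) < 1 - p := sub_pos.2 h1
  refine Subtype.ext ?_
  rw [coe_concatFun, coe_upperPart, coe_upperPart]
  have e1 : ((p : ℝ) + (1 - p) * t - p) / (1 - p) = t := by field_simp; ring
  have e2 : 1 ≤ ((p : ℝ) + (1 - p) * t) / p := by
    rw [one_le_div h0']; nlinarith [t.2.1]
  have e3 := apply_one f
  rw [e1, Set.projIcc_val, Set.projIcc_of_right_le _ e2]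
  change (p : ℝ) * (f.1 1 : unitInterval) + (1 - p) * g.1 t = _
  rw [e3]
  simp

/-- Thanks to the clamping, each summand is monotone on all of `I`, so no case split at `p` is
needed. -/
theorem monotone_concatFun (p : unitInterval) (f g : HomeoPlusI) :
    Monotone (concatFun p f.1 g.1) := by
  intro x y hxy
  have hxy' : (x : ℝ) ≤ y := hxy
  have hp : (0 : ℝ) ≤ p := p.2.1
  have hp' : (0 : ℝ) ≤ 1 - p := sub_nonneg.2 p.2.2
  rw [← Subtype.coe_le_coe, coe_concatFun, coe_concatFun]
  refine add_le_add (mul_le_mul_of_nonneg_left ?_ hp) (mul_le_mul_of_nonneg_left ?_ hp')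
  · exact (apply_le_apply f).2 (Set.monotone_projIcc _ (by gcongr))
  · exact (apply_le_apply g).2 (Set.monotone_projIcc _ (by gcongr))

theorem concatFun_comp {p : unitInterval} (h0 : 0 < p) (h1 : p < 1) (f g f' g' : HomeoPlusI)
    (x : unitInterval) : concatFun p f.1 g.1 (concatFun p f'.1 g'.1 x) =
      concatFun p (f * f').1 (g * g').1 x := by
  rcases lowerPart_or_upperPart h0 h1 x with ⟨t, rfl⟩ | ⟨t, rfl⟩
  · simp only [concatFun_lowerPart h0 h1, mul_apply]
  · simp only [concatFun_upperPart h0 h1, mul_apply]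

theorem concatFun_one {p : unitInterval} (h0 : 0 < p) (h1 : p < 1) (x : unitInterval) :
    concatFun p (1 : HomeoPlusI).1 (1 : HomeoPlusI).1 x = x := by
  rcases lowerPart_or_upperPart h0 h1 x with ⟨t, rfl⟩ | ⟨t, rfl⟩
  · rw [concatFun_lowerPart h0 h1]; rfl
  · rw [concatFun_upperPart h0 h1]; rfl

/-- The embedding of `Homeo₊(I) × Homeo₊(I)` in `Homeo₊(I)` with image the stabilizer of `p`. -/
noncomputable def concat (p : unitInterval) (h0 : 0 < p) (h1 : p < 1) :
    HomeoPlusI × HomeoPlusI →* HomeoPlusI where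
  toFun q := ofOrderIso <| Equiv.toOrderIso
    { toFun := concatFun p q.1.1 q.2.1
      invFun := concatFun p q.1⁻¹.1 q.2⁻¹.1
      left_inv := fun x => by
        rw [concatFun_comp h0 h1, inv_mul_cancel, inv_mul_cancel, concatFun_one h0 h1]
      right_inv := fun x => by
        rw [concatFun_comp h0 h1, mul_inv_cancel, mul_inv_cancel, concatFun_one h0 h1] }
    (monotone_concatFun p q.1 q.2) (monotone_concatFun p q.1⁻¹ q.2⁻¹)
  map_one' := Subtype.ext (Homeomorph.ext fun x => concatFun_one h0 h1 x)
  map_mul' q r := Subtype.ext (Homeomorph.ext fun x => (concatFun_comp h0 h1 _ _ _ _ x).symm)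

variable {p : unitInterval} (h0 : 0 < p) (h1 : p < 1)

theorem concat_lowerPart (q : HomeoPlusI × HomeoPlusI) (t : unitInterval) :
    (concat p h0 h1 q).1 (lowerPart p t) = lowerPart p (q.1.1 t) :=
  concatFun_lowerPart h0 h1 q.1 q.2 t

theorem concat_upperPart (q : HomeoPlusI × HomeoPlusI) (t : unitInterval) :
    (concat p h0 h1 q).1 (upperPart p t) = upperPart p (q.2.1 t) :=
  concatFun_upperPart h0 h1 q.1 q.2 t

theorem concat_apply_self (q : HomeoPlusI × HomeoPlusI) : (concat p h0 h1 q).1 p = p := by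
  have h : upperPart p 0 = p := Subtype.ext (by simp [coe_upperPart])
  have := concat_upperPart h0 h1 q 0
  rwa [apply_zero, h] at this

/-- On `[0, p]` both maps take values below `ε / 2`, whatever `k` is. On `[p, 1]` the rescaling
moves both the argument and the value of `g` by at most `p`. -/
theorem dist_concat_lt (k g : HomeoPlusI) {ε η : ℝ} (hpη : (p : ℝ) < η) (hpε : (p : ℝ) < ε / 2)
    (hg : ∀ x y : unitInterval, dist x y < η → dist (g.1 x) (g.1 y) < ε / 2) :
    dist (concat p h0 h1 (k, g)) g < ε := by
  have h0' : (0 : ℝ) < p := h0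
  refine (dist_lt_iff _ _ (by linarith)).2 fun x => ?_
  rcases lowerPart_or_upperPart h0 h1 x with ⟨t, rfl⟩ | ⟨t, rfl⟩
  · rw [concat_lowerPart, coe_lowerPart]
    have hk := (k.1 t).2
    have ht := t.2
    have := hg (lowerPart p t) 0 (by
      rw [Subtype.dist_eq, Real.dist_eq, coe_lowerPart, Set.Icc.coe_zero, sub_zero,
        abs_of_nonneg (mul_nonneg h0'.le ht.1)]
      nlinarith [ht.2])
    rw [apply_zero, Subtype.dist_eq, Real.dist_eq, abs_lt] at this
    simp only [Set.Icc.coe_zero, sub_zero] at this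
    have hm1 := mul_nonneg h0'.le hk.1
    have hm2 := mul_le_of_le_one_right h0'.le hk.2
    rw [abs_lt]
    constructor <;> linarith [(g.1 (lowerPart p t)).2.1]
  · rw [concat_upperPart, coe_upperPart]
    have hk := (g.1 t).2
    have ht := t.2
    have := hg (upperPart p t) t (by
      rw [Subtype.dist_eq, Real.dist_eq, coe_upperPart, abs_lt]
      constructor <;> nlinarith [ht.1, ht.2])
    rw [Subtype.dist_eq, Real.dist_eq, abs_lt] at this
    have hm1 := mul_nonneg h0'.le hk.1
    have hm2 := mul_le_of_le_one_right h0'.le hk.2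
    rw [abs_lt]
    constructor <;> linarith

end Concat

/-! ### Discrete, non-dense perturbations -/

/-- The stabilizer of `p` is closed, and it is proper because a translation of the line moves `p`.
-/
theorem not_generatesDense_of_fixed {n : ℕ} {h : Fin n → HomeoPlusI} {p : unitInterval}
    (h0 : 0 < p) (h1 : p < 1) (hp : ∀ i, (h i).1 p = p) : ¬ GeneratesDense h := by
  intro hd
  have hev : Continuous fun f : HomeoPlusI => f.1 p :=
    (continuous_eval_const (F := C(unitInterval, unitInterval)) p).comp continuous_toMap
  have hsub : (Subgroup.closure (Set.range h) : Set HomeoPlusI) ⊆ {f | f.1 p = p} := by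
    intro f hf
    induction hf using Subgroup.closure_induction with
    | mem f hf => obtain ⟨i, rfl⟩ := hf; exact hp i
    | one => rfl
    | mul f g _ _ hf hg =>
      change f.1 (g.1 p) = p
      rw [show g.1 p = p from hg, show f.1 p = p from hf]
    | inv f _ hf => exact (Homeomorph.symm_apply_eq _).2 (show f.1 p = p from hf).symm
  have hall : ∀ f : HomeoPlusI, f.1 p = p := fun f =>
    closure_minimal hsub (isClosed_singleton.preimage hev) (hd f)
  obtain ⟨u, rfl⟩ := exists_coe_of_lt_of_lt h0 h1
  have := hall (lineHom (OrderIso.addRight 1))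
  rw [lineHom_apply_coe, OrderIso.apply_eq_iff_eq, EReal.coe_eq_coe_iff] at this
  simp at this

/-- By right invariance `dist a b = dist (a * b⁻¹) 1`, and `a * b⁻¹` is a nontrivial word when `a ≠
b`. -/
theorem generatesDiscrete_of_displacement {n : ℕ} {h : Fin n → HomeoPlusI} (x : unitInterval)
    {δ : ℝ} (hδ : 0 < δ)
    (hw : ∀ w : FreeGroup (Fin n), w ≠ 1 → δ ≤ |((FreeGroup.lift h w).1 x : ℝ) - x|) :
    GeneratesDiscrete h := by
  refine DiscreteTopology.of_forall_le_dist hδ fun a b hab => ?_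
  have hmem := Subgroup.mul_mem _ a.2 (Subgroup.inv_mem _ b.2)
  obtain ⟨w, hwab⟩ := FreeGroup.range_lift_eq_closure.ge hmem
  have hw1 : w ≠ 1 := by
    rintro rfl
    rw [map_one] at hwab
    exact hab (Subtype.ext (mul_inv_eq_one.1 hwab.symm))
  have hdist := dist_mul_right (a : HomeoPlusI) b b⁻¹
  rw [mul_inv_cancel] at hdist
  change δ ≤ dist (a : HomeoPlusI) b
  rw [← hdist, ← hwab]
  exact le_dist_of_apply x (hw w hw1)

theorem exists_dist_lt_generatesDiscrete {n : ℕ} (g : Fin n → HomeoPlusI) {ε : ℝ} (hε : 0 < ε) :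
    ∃ h : Fin n → HomeoPlusI,
      (∀ i, dist (h i) (g i) < ε) ∧ GeneratesDiscrete h ∧ ¬ GeneratesDense h := by
  obtain ⟨k, x, δ, hδ, hk⟩ := exists_uniform_displacement n
  have huc : UniformContinuous fun x : unitInterval => fun i => (g i).1 x :=
    CompactSpace.uniformContinuous_of_continuous (continuous_pi fun i => (g i).1.continuous)
  obtain ⟨η, hη, hg⟩ := Metric.uniformContinuous_iff.1 huc (ε / 2) (by positivity)
  obtain ⟨r, hr0, hr⟩ := exists_between (lt_min one_pos (lt_min hη (half_pos hε)))
  rw [lt_min_iff, lt_min_iff] at hr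
  set p : unitInterval := ⟨r, hr0.le, hr.1.le⟩
  have h0 : 0 < p := hr0
  have h1 : p < 1 := hr.1
  refine ⟨fun i => concat p h0 h1 (k i, g i), fun i => ?_, ?_, ?_⟩
  · exact dist_concat_lt h0 h1 _ _ hr.2.1 hr.2.2 fun x y hxy =>
      (dist_pi_lt_iff (half_pos hε)).1 (hg hxy) i
  · refine generatesDiscrete_of_displacement (lowerPart p x) (mul_pos hr0 hδ) fun w hw => ?_
    have hcomp : FreeGroup.lift (fun i => concat p h0 h1 (k i, g i)) =
        (concat p h0 h1).comp ((FreeGroup.lift k).prod (FreeGroup.lift g)) :=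
      FreeGroup.ext_hom _ _ fun i => by simp
    rw [hcomp]
    change r * δ ≤ |(((concat p h0 h1) (FreeGroup.lift k w, FreeGroup.lift g w)).1 _ : ℝ) - _|
    rw [concat_lowerPart, coe_lowerPart, coe_lowerPart, ← mul_sub, abs_mul, abs_of_pos hr0]
    exact mul_le_mul_of_nonneg_left (hk w hw) hr0.le
  · exact not_generatesDense_of_fixed h0 h1 fun i => concat_apply_self h0 h1 _

open scoped Pointwise in
theorem not_stabilityOfGenerators : ¬ StabilityOfGenerators HomeoPlusI := by
  intro hS
  obtain ⟨U, hU, h1, hd⟩ := hS 3 _ generatesDense_lineGenerators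
  set g : Fin 3 → HomeoPlusI := fun i => lineHom (lineGenerators i)
  -- Openness in the finite product turns the neighbourhoods `g i • U` into a single `ε`.
  have hopen : IsOpen (Set.univ.pi fun i => g i • U) :=
    isOpen_set_pi Set.finite_univ fun i _ => hU.smul (g i)
  have hmem : g ∈ Set.univ.pi fun i => g i • U := fun i _ =>
    ⟨1, h1, mul_one (g i)⟩
  obtain ⟨ε, hε, hball⟩ := Metric.isOpen_iff.1 hopen g hmem
  obtain ⟨h, hh, -, hnd⟩ := exists_dist_lt_generatesDiscrete g hε
  exact hnd (hd h fun i => hball ((dist_pi_lt_iff hε).2 hh) i trivial)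

end HomeoPlusI

theorem theorem0p3 :
    -- `Homeo₊(I)` does not have the Stability of the Generators Property.
    ¬ StabilityOfGenerators HomeoPlusI ∧
    -- Some tuple generates a dense subgroup but has arbitrarily small perturbations
    -- that generate a discrete, non-dense subgroup.
    (∃ (n : ℕ) (g : Fin n → HomeoPlusI), GeneratesDense g ∧
      ∀ ε : ℝ, 0 < ε → ∃ h : Fin n → HomeoPlusI,
        (∀ i, dist (h i) (g i) < ε) ∧ GeneratesDiscrete h ∧ ¬ GeneratesDense h) ∧
    -- Every tuple that generates a dense subgroup is unstable in this way.
    (∀ (n : ℕ) (g : Fin n → HomeoPlusI), GeneratesDense g →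
      ∀ ε : ℝ, 0 < ε → ∃ h : Fin n → HomeoPlusI,
        (∀ i, dist (h i) (g i) < ε) ∧ GeneratesDiscrete h ∧ ¬ GeneratesDense h) :=
  ⟨HomeoPlusI.not_stabilityOfGenerators,
    ⟨3, _, HomeoPlusI.generatesDense_lineGenerators, fun _ hε =>
      HomeoPlusI.exists_dist_lt_generatesDiscrete _ hε⟩,
    fun _ g _ _ hε => HomeoPlusI.exists_dist_lt_generatesDiscrete g hε⟩
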